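/- Let $N\ge 2$, let $\Omega_0\subset\mathbb{R}^N$ be a bounded open set (in particular, it may be a bounded strictly convex domain), let $\sigma$ be the surface measure on the unit sphere $S^{N-1}$, and let $\varepsilon>0$, $K>0$ and $0<\delta<\tfrac12\sigma(S^{N-1})$. Call a measurable set $A\subset S^{N-1}$ admissible if $\sigma(A)\ge\tfrac12\sigma(S^{N-1})+\delta$, and for a Borel function $u:\mathbb{R}^N\to\mathbb{R}$ such that $v\mapsto u(x+\varepsilon v)$ is $\sigma$-integrable on $S^{N-1}$ for every $x\in\Omega_0$ put $$T u(x)=\sup_{A}\inf_{B}\frac{1}{\sigma(A\cap B)}\int_{A\cap B}u(x+\varepsilon v)\,d\sigma(v),\qquad x\in\Omega_0,$$ where $A$ and $B$ range over the admissible sets. All functions below are of this class. (i) There exists a unique function $u$ such that $$u(x)=Tu(x)+\varepsilon^2K\quad\text{for }x\in\Omega_0,\qquad u(x)=0\quad\text{for }x\in\mathbb{R}^N\setminus\Omega_0 .$$ (ii) If $\overline u$ is a supersolution, that is, $\overline u\ge T\overline u+\varepsilon^2K$ in $\Omega_0$ and $\overline u\ge 0$ in $\mathbb{R}^N\setminus\Omega_0$,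 and $\underline u$ is a subsolution, that is, $\underline u\le T\underline u+\varepsilon^2K$ in $\Omega_0$ and $\underline u\le 0$ in $\mathbb{R}^N\setminus\Omega_0$, then $\overline u(x)\ge\underline u(x)$ for every $x\in\mathbb{R}^N$. -/

import Mathlib

open MeasureTheory Metric

noncomputable section

/-- The surface measure `σ` on the unit sphere `S^{N-1}` of `ℝ^N`. -/
def surfaceMeasure (N : ℕ) : Measure (sphere (0 : EuclideanSpace ℝ (Fin N)) 1) :=
  (volume : Measure (EuclideanSpace ℝ (Fin N))).toSphere

/-- The choices of a player: the measurable subsets of the sphere of surface measure at least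
`σ(S^{N-1}) / 2 + δ`. -/
def admissibleSets (N : ℕ) (δ : ℝ) : Set (Set (sphere (0 : EuclideanSpace ℝ (Fin N)) 1)) :=
  {A | MeasurableSet A ∧
    (1 / 2) * (surfaceMeasure N).real Set.univ + δ ≤ (surfaceMeasure N).real A}

/-- `sup_A inf_B ⨍_{A ∩ B} u(x + ε v) dσ(v)`, with `A`, `B` ranging over the admissible sets. -/
def gameOperator {N : ℕ} (ε δ : ℝ) (u : EuclideanSpace ℝ (Fin N) → ℝ)
    (x : EuclideanSpace ℝ (Fin N)) : ℝ :=
  ⨆ A : admissibleSets N δ, ⨅ B : admissibleSets N δ,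
    ⨍ v in (A : Set (sphere (0 : EuclideanSpace ℝ (Fin N)) 1)) ∩ B,
      u (x + ε • (v : EuclideanSpace ℝ (Fin N))) ∂(surfaceMeasure N)

/-- The functions for which the averages in the equation make sense: Borel functions that are
`σ`-integrable on each sphere of radius `ε` centred in `Ω`. -/
structure IsDPPFunction {N : ℕ} (Ω : Set (EuclideanSpace ℝ (Fin N))) (ε : ℝ)
    (u : EuclideanSpace ℝ (Fin N) → ℝ) : Prop where
  measurable : Measurable u
  integrable : ∀ x ∈ Ω, Integrable
    (fun v : sphere (0 : EuclideanSpace ℝ (Fin N)) 1 =>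
      u (x + ε • (v : EuclideanSpace ℝ (Fin N)))) (surfaceMeasure N)

structure IsDPPSolution {N : ℕ} (Ω : Set (EuclideanSpace ℝ (Fin N))) (ε δ K : ℝ)
    (u : EuclideanSpace ℝ (Fin N) → ℝ) : Prop extends IsDPPFunction Ω ε u where
  eq_inside : ∀ x ∈ Ω, u x = gameOperator ε δ u x + ε ^ 2 * K
  eq_outside : ∀ x, x ∉ Ω → u x = 0

structure IsDPPSupersolution {N : ℕ} (Ω : Set (EuclideanSpace ℝ (Fin N))) (ε δ K : ℝ)
    (u : EuclideanSpace ℝ (Fin N) → ℝ) : Prop extends IsDPPFunction Ω ε u where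
  ge_inside : ∀ x ∈ Ω, gameOperator ε δ u x + ε ^ 2 * K ≤ u x
  ge_outside : ∀ x, x ∉ Ω → 0 ≤ u x

structure IsDPPSubsolution {N : ℕ} (Ω : Set (EuclideanSpace ℝ (Fin N))) (ε δ K : ℝ)
    (u : EuclideanSpace ℝ (Fin N) → ℝ) : Prop extends IsDPPFunction Ω ε u where
  le_inside : ∀ x ∈ Ω, u x ≤ gameOperator ε δ u x + ε ^ 2 * K
  le_outside : ∀ x, x ∉ Ω → u x ≤ 0

end

open scoped Topology RealInnerProductSpace ENNReal Pointwise

/-! Two admissible sets meet in measure at least `2 * δ`, so on each sphere the game value is order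
preserving, positively homogeneous and Lipschitz for the `L¹` norm.

Comparison: for `r > 1` the multiple `r * uSuper` is a supersolution with surplus `(r - 1) * (ε ^ 2
* K)`, which prevents a finite supremum of `uSub - r * uSuper` from being positive; then `r → 1`.
The difficulty is finiteness, as only integrability on spheres is assumed. If a subsolution is large
at a point, it is almost as large on a fixed fraction of the surrounding sphere, since otherwise the
minimizing player would avoid the large values; negative values of supersolutions behave likewise.
After two steps, a fixed mass of the law of `ε • v + ε • w` lies in a translate of a superlevel set.
For `N ≥ 2` this law is absolutely continuous, whereas the volume of high superlevel sets tends to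
zero, so `bddAbove_of_large_values_propagate` yields the bound.

Existence: value iteration from `0` increases, stays below a paraboloid (the antipodal answer `B =
-A` makes it a supersolution), and converges to a solution by dominated convergence. The iterates
are Borel because a countable dense family of admissible sets computes the game value. -/

/-! ### Null sets and the sum of two generic directions. -/

/-- A map that is `C^1` with injective derivative at every point of `G` pulls Lebesgue-null sets
back to null sets on `G`. -/
theorem measure_inter_preimage_eq_zero_of_injective_fderiv {E : Type*} [NormedAddCommGroup E]
    [NormedSpace ℝ E] [FiniteDimensional ℝ E] [MeasurableSpace E] [BorelSpace E]
    (μ : Measure E) [μ.IsAddHaarMeasure] {f : E → E} {G T : Set E}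
    (hf : ∀ x ∈ G, ∃ f' : E →L[ℝ] E, ContDiffAt ℝ 1 f x ∧ HasFDerivAt f f' x ∧
      Function.Injective f')
    (hT : μ T = 0) : μ (G ∩ f ⁻¹' T) = 0 := by
  refine measure_null_of_locally_null _ fun x hx => ?_
  obtain ⟨f', hc, hd, hinj⟩ := hf x hx.1
  let e : E ≃L[ℝ] E := (LinearEquiv.ofInjectiveEndo (f' : E →ₗ[ℝ] E) hinj).toContinuousLinearEquiv
  have he : (e : E →L[ℝ] E) = f' := by ext y; rfl
  rw [← he] at hd
  have hs : HasStrictFDerivAt f (e : E →L[ℝ] E) x := hc.hasStrictFDerivAt' hd one_ne_zero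
  have hg : ContDiffAt ℝ 1 (hc.localInverse hd one_ne_zero) (f x) :=
    hc.to_localInverse hd one_ne_zero
  obtain ⟨V, hV, hVd⟩ := hg.contDiffOn (m := 1) le_rfl (by simp)
  have hVd' := hVd.differentiableOn one_ne_zero
  have hleft := hs.eventually_left_inverse
  refine ⟨{y | hs.localInverse f e x (f y) = y} ∩ f ⁻¹' V ∩ (G ∩ f ⁻¹' T), ?_, ?_⟩
  · exact Filter.inter_mem (mem_nhdsWithin_of_mem_nhds
      (Filter.inter_mem hleft (hc.continuousAt.preimage_mem_nhds hV))) self_mem_nhdsWithin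
  -- Near `x` the preimage lies in the image of a null set under the differentiable local inverse.
  · refine measure_mono_null (t := hs.localInverse f e x '' (T ∩ V)) ?_ ?_
    · rintro y ⟨⟨hy, hyV⟩, -, hyT⟩
      exact ⟨f y, ⟨hyT, hyV⟩, hy⟩
    · exact addHaar_image_eq_zero_of_differentiableOn_of_addHaar_eq_zero μ
        (hVd'.mono Set.inter_subset_right) (measure_mono_null Set.inter_subset_left hT)

section Direction

variable {E : Type*} [NormedAddCommGroup E] [InnerProductSpace ℝ E]

/-- The derivative of the radial projection `x ↦ ‖x‖⁻¹ • x`. -/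
theorem exists_hasFDerivAt_norm_inv_smul {x : E} (hx : x ≠ 0) :
    ∃ D : E →L[ℝ] E, HasFDerivAt (fun z : E => ‖z‖⁻¹ • z) D x ∧
      ∀ h, D h = ‖x‖⁻¹ • h - (‖x‖⁻¹ ^ 3 * ⟪x, h⟫) • x := by
  have hn : ‖x‖ ≠ 0 := norm_ne_zero_iff.2 hx
  have h1 : HasFDerivAt (fun z : E => ‖z‖ ^ 2) (2 • innerSL ℝ x) x :=
    (hasStrictFDerivAt_norm_sq x).hasFDerivAt
  have h2 : HasFDerivAt (fun z : E => ‖z‖) ((1 / (2 * √(‖x‖ ^ 2))) • (2 • innerSL ℝ x)) x := by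
    have := h1.sqrt (pow_ne_zero 2 hn)
    simpa only [Real.sqrt_sq (norm_nonneg _)] using this
  have h3 : HasFDerivAt (fun z : E => ‖z‖⁻¹) _ x := (hasDerivAt_inv hn).comp_hasFDerivAt x h2
  refine ⟨_, h3.smul (hasFDerivAt_id x), fun h => ?_⟩
  rw [Real.sqrt_sq (norm_nonneg _)]
  simp only [add_apply, smul_apply,
    ContinuousLinearMap.smulRight_apply, ContinuousLinearMap.id_apply, innerSL_apply_apply,
    smul_eq_mul, nsmul_eq_mul, Nat.cast_ofNat]
  rw [sub_eq_add_neg, ← neg_smul]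
  congr 2
  field_simp

/-- The radial projection has constant norm, so its derivative is tangential. -/
theorem inner_radial_derivative {x : E} (hx : x ≠ 0) (h : E) :
    ⟪x, ‖x‖⁻¹ • h - (‖x‖⁻¹ ^ 3 * ⟪x, h⟫) • x⟫ = 0 := by
  have hn : ‖x‖ ≠ 0 := norm_ne_zero_iff.2 hx
  rw [inner_sub_right, inner_smul_right, inner_smul_right, real_inner_self_eq_norm_sq]
  field_simp
  ring

/-- The map whose first component is the sum of the directions of the two arguments, completed to a
local diffeomorphism at generic points. -/
noncomputable def directionSumMap (e : E) (p : E × E) : E × E :=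
  (‖p.1‖⁻¹ • p.1 + ‖p.2‖⁻¹ • p.2, p.2 - ‖p.1‖ ^ 2 • e)

theorem contDiffAt_directionSumMap (e : E) {p : E × E} (h1 : p.1 ≠ 0) (h2 : p.2 ≠ 0) :
    ContDiffAt ℝ 1 (directionSumMap e) p := by
  have a1 : ContDiffAt ℝ 1 (fun q : E × E => ‖q.1‖) p := contDiffAt_fst.norm ℝ h1
  have a2 : ContDiffAt ℝ 1 (fun q : E × E => ‖q.2‖) p := contDiffAt_snd.norm ℝ h2
  have b1 := a1.inv (norm_ne_zero_iff.2 h1)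
  have b2 := a2.inv (norm_ne_zero_iff.2 h2)
  exact ((b1.smul contDiffAt_fst).add (b2.smul contDiffAt_snd)).prodMk
    (contDiffAt_snd.sub ((a1.pow 2).smul contDiffAt_const))

/-- For `(a, b)` in the kernel, the second component gives `b = 2⟪p.1, a⟫ e`. Pairing the first with
`p.1` removes the contribution of `a` and leaves `⟪p.1, a⟫` times a nonzero multiple of the quantity
in `h`. Hence `⟪p.1, a⟫ = 0`, so `b = 0` and then `a = 0`. -/
theorem exists_injective_hasFDerivAt_directionSumMap {e : E} {p : E × E} (h1 : p.1 ≠ 0)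
    (h2 : p.2 ≠ 0) (h : ⟪p.1, ‖p.2‖ ^ 2 • e - ⟪p.2, e⟫ • p.2⟫ ≠ 0) :
    ∃ D : E × E →L[ℝ] E × E, HasFDerivAt (directionSumMap e) D p ∧ Function.Injective D := by
  obtain ⟨D1, hD1, hD1'⟩ := exists_hasFDerivAt_norm_inv_smul h1
  obtain ⟨D2, hD2, hD2'⟩ := exists_hasFDerivAt_norm_inv_smul h2
  have k1 : HasFDerivAt (fun q : E × E => ‖q.1‖⁻¹ • q.1) _ p := hD1.comp p hasFDerivAt_fst
  have k2 : HasFDerivAt (fun q : E × E => ‖q.2‖⁻¹ • q.2) _ p := hD2.comp p hasFDerivAt_snd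
  have k3 : HasFDerivAt (fun q : E × E => ‖q.1‖ ^ 2) _ p :=
    (hasStrictFDerivAt_norm_sq p.1).hasFDerivAt.comp p hasFDerivAt_fst
  refine ⟨_, (k1.add k2).prodMk (hasFDerivAt_snd.sub (k3.smul_const e)), ?_⟩
  refine (injective_iff_map_eq_zero _).2 ?_
  rintro ⟨a, b⟩ hab
  have hn1 : ‖p.1‖ ≠ 0 := norm_ne_zero_iff.2 h1
  have hn2 : ‖p.2‖ ≠ 0 := norm_ne_zero_iff.2 h2
  have hA : D1 a + D2 b = 0 := congrArg Prod.fst hab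
  have hB : b = (2 * ⟪p.1, a⟫) • e := by
    have := congrArg Prod.snd hab
    simpa [sub_eq_zero] using this
  have hC : ⟪p.1, a⟫ = 0 := by
    have := congrArg (fun z => ⟪p.1, z⟫) hA
    simp only [inner_add_right, inner_zero_right] at this
    rw [hD1', inner_radial_derivative h1, zero_add, hB, map_smul, inner_smul_right, hD2'] at this
    rcases mul_eq_zero.1 this with h0 | h0
    · linarith
    · exfalso
      apply h
      rw [inner_sub_right, inner_smul_right, inner_smul_right] at h0 ⊢
      have h0' := congrArg (fun t => t * ‖p.2‖ ^ 3) h0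
      simp only [zero_mul] at h0'
      field_simp at h0'
      linarith
  have hb : b = 0 := by rw [hB, hC]; simp
  have ha : a = 0 := by
    rw [hb, map_zero, add_zero, hD1', hC] at hA
    simpa [hn1, h1] using hA
  rw [ha, hb]; rfl

end Direction

/-- If `T` is Lebesgue-null then the sum of two generic directions avoids `T`. -/
theorem ae_ae_direction_add_notMem {E : Type*} [NormedAddCommGroup E] [InnerProductSpace ℝ E]
    [FiniteDimensional ℝ E] [MeasurableSpace E] [BorelSpace E] (hE : 2 ≤ Module.finrank ℝ E)
    {T : Set E} (hT : volume T = 0) :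
    ∀ᵐ p : E × E, ‖p.1‖⁻¹ • p.1 + ‖p.2‖⁻¹ • p.2 ∉ T := by
  have : Nontrivial E := Module.nontrivial_of_finrank_pos (R := ℝ) (by omega)
  obtain ⟨e, he⟩ := exists_ne (0 : E)
  have hspan : volume ((Submodule.span ℝ {e} : Submodule ℝ E) : Set E) = 0 := by
    refine Measure.addHaar_submodule _ _ fun htop => ?_
    have h1 := finrank_span_singleton (K := ℝ) he
    rw [htop, finrank_top] at h1
    omega
  have hgood : ∀ᵐ p : E × E, p.1 ≠ 0 ∧ p.2 ≠ 0 ∧ ⟪p.1, ‖p.2‖ ^ 2 • e - ⟪p.2, e⟫ • p.2⟫ ≠ 0 := by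
    have hmeas : MeasurableSet {p : E × E |
        p.1 ≠ 0 ∧ p.2 ≠ 0 ∧ ⟪p.1, ‖p.2‖ ^ 2 • e - ⟪p.2, e⟫ • p.2⟫ ≠ 0} := by
      refine IsOpen.measurableSet ?_
      refine (isOpen_ne_fun continuous_fst continuous_const).inter
        ((isOpen_ne_fun continuous_snd continuous_const).inter
        (isOpen_ne_fun (by fun_prop) continuous_const))
    -- Fubini with the second vector fixed first: once `y` is off the line through `e`, the bad `x`
    -- form a hyperplane.
    have hswap : ∀ᵐ p : E × E, p.2 ≠ 0 ∧ p.1 ≠ 0 ∧ ⟪p.2, ‖p.1‖ ^ 2 • e - ⟪p.1, e⟫ • p.1⟫ ≠ 0 := by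
      rw [Measure.volume_eq_prod]
      refine (Measure.ae_prod_iff_ae_ae (measurable_swap hmeas)).2 ?_
      have hy : ∀ᵐ y : E, y ∉ Submodule.span ℝ {e} := by
        rw [ae_iff]; simpa using hspan
      filter_upwards [hy] with y hy
      have hy0 : y ≠ 0 := fun h => hy (h ▸ Submodule.zero_mem _)
      have hw : ‖y‖ ^ 2 • e - ⟪y, e⟫ • y ≠ 0 := by
        intro h0
        have hye : ⟪y, e⟫ ≠ 0 := by
          intro h1
          rw [h1, zero_smul, sub_zero] at h0
          simp [he, hy0] at h0
        apply hy
        rw [Submodule.mem_span_singleton]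
        refine ⟨⟪y, e⟫⁻¹ * ‖y‖ ^ 2, ?_⟩
        rw [mul_smul, sub_eq_zero.1 h0, smul_smul, inv_mul_cancel₀ hye, one_smul]
      have hperp : volume (((ℝ ∙ (‖y‖ ^ 2 • e - ⟪y, e⟫ • y))ᗮ : Submodule ℝ E) : Set E) = 0 := by
        refine Measure.addHaar_submodule _ _ fun htop => hw ?_
        have : ‖y‖ ^ 2 • e - ⟪y, e⟫ • y ∈ (ℝ ∙ (‖y‖ ^ 2 • e - ⟪y, e⟫ • y))ᗮ := htop ▸ trivial
        rw [Submodule.mem_orthogonal_singleton_iff_inner_right] at this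
        exact inner_self_eq_zero.1 this
      have hx : ∀ᵐ x : E, x ∉ (ℝ ∙ (‖y‖ ^ 2 • e - ⟪y, e⟫ • y))ᗮ := by
        rw [ae_iff]; simpa using hperp
      filter_upwards [hx] with x hx
      rw [Submodule.mem_orthogonal_singleton_iff_inner_left] at hx
      refine ⟨?_, hy0, hx⟩
      rintro rfl
      simp at hx
    exact (Measure.measurePreserving_swap (μ := (volume : Measure E))
      (ν := (volume : Measure E))).quasiMeasurePreserving.ae hswap
  have hTT : (volume : Measure E).prod volume (T ×ˢ (Set.univ : Set E)) = 0 := by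
    rw [Measure.prod_prod, hT, zero_mul]
  have key := measure_inter_preimage_eq_zero_of_injective_fderiv ((volume : Measure E).prod volume)
    (f := directionSumMap e) (G := {p : E × E |
        p.1 ≠ 0 ∧ p.2 ≠ 0 ∧ ⟪p.1, ‖p.2‖ ^ 2 • e - ⟪p.2, e⟫ • p.2⟫ ≠ 0})
    (fun p hp => by
      obtain ⟨D, hD, hi⟩ := exists_injective_hasFDerivAt_directionSumMap hp.1 hp.2.1 hp.2.2
      exact ⟨D, contDiffAt_directionSumMap e hp.1 hp.2.1, hD, hi⟩) hTT
  have key' : ∀ᵐ p : E × E, ¬ (p ∈ {p : E × E |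
        p.1 ≠ 0 ∧ p.2 ≠ 0 ∧ ⟪p.1, ‖p.2‖ ^ 2 • e - ⟪p.2, e⟫ • p.2⟫ ≠ 0} ∩
        directionSumMap e ⁻¹' (T ×ˢ Set.univ)) := by
    rw [ae_iff]; simpa only [not_not] using! key
  filter_upwards [hgood, key'] with p hp hp' hmem
  exact hp' ⟨hp, hmem, trivial⟩

/-! ### Surface measure: cones, two-step law, antipodal symmetry. -/

instance isFiniteMeasure_surfaceMeasure (N : ℕ) : IsFiniteMeasure (surfaceMeasure N) := by
  unfold surfaceMeasure; infer_instance

/-- A null set on the sphere is detected by the cone over it. -/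
theorem toSphere_eq_zero_of_direction_null {E : Type*} [NormedAddCommGroup E] [NormedSpace ℝ E]
    [MeasurableSpace E] [BorelSpace E] (μ : Measure E) {s : Set (sphere (0 : E) 1)}
    (hs : MeasurableSet s) (h : μ {x | ‖x‖⁻¹ • x ∈ ((↑) '' s : Set E)} = 0) :
    μ.toSphere s = 0 := by
  rw [μ.toSphere_apply' hs]
  refine mul_eq_zero_of_right _ (measure_mono_null ?_ h)
  rintro _ ⟨r, hr, _, ⟨v, hv, rfl⟩, rfl⟩
  refine ⟨v, hv, ?_⟩
  have hv1 : ‖(v : E)‖ = 1 := by simp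
  have hr0 : r ≠ 0 := hr.1.ne'
  simp [norm_smul, hv1, abs_of_pos hr.1, smul_smul, hr0]

/-- The law of the sum of two independent uniform directions, scaled by `ε`, charges no
Lebesgue-null set. -/
theorem map_sphere_add_absolutelyContinuous {N : ℕ} (hN : 2 ≤ N) {ε : ℝ} (hε : 0 < ε) :
    ((surfaceMeasure N).prod (surfaceMeasure N)).map
      (fun p => ε • (p.1 : EuclideanSpace ℝ (Fin N)) + ε • (p.2 : EuclideanSpace ℝ (Fin N)))
      ≪ volume := by
  refine Measure.AbsolutelyContinuous.mk fun T hTm hT => ?_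
  have hmeas : Measurable (fun p : sphere (0 : EuclideanSpace ℝ (Fin N)) 1 ×
      sphere (0 : EuclideanSpace ℝ (Fin N)) 1 =>
      ε • (p.1 : EuclideanSpace ℝ (Fin N)) + ε • (p.2 : EuclideanSpace ℝ (Fin N))) := by
    fun_prop
  rw [Measure.map_apply hmeas hTm, Measure.measure_prod_null (hmeas hTm)]
  have hT' : volume ((fun z : EuclideanSpace ℝ (Fin N) => ε • z) ⁻¹' T) = 0 := by
    rw [Measure.addHaar_preimage_smul _ hε.ne', hT, mul_zero]
  have h0 := ae_ae_direction_add_notMem (E := EuclideanSpace ℝ (Fin N)) (by simpa using hN) hT'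
  rw [Measure.volume_eq_prod] at h0
  have h1 := Measure.ae_ae_of_ae_prod h0
  -- The statement on the product descends to the sphere one variable at a time, through cones: `w`
  -- here, `v` below.
  have h2 : ∀ᵐ x : EuclideanSpace ℝ (Fin N), surfaceMeasure N
      {w | ε • (‖x‖⁻¹ • x) + ε • (w : EuclideanSpace ℝ (Fin N)) ∈ T} = 0 := by
    filter_upwards [h1] with x hx
    have hm : Measurable (fun w : sphere (0 : EuclideanSpace ℝ (Fin N)) 1 =>
      ε • (‖x‖⁻¹ • x) + ε • (w : EuclideanSpace ℝ (Fin N))) := by fun_prop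
    refine toSphere_eq_zero_of_direction_null _ (hm hTm) (measure_mono_null ?_ hx)
    rintro y ⟨w, hw, hwy⟩
    simp only [Set.mem_compl_iff, Set.mem_ofPred_eq, not_not, Set.mem_preimage] at hw ⊢
    rw [smul_add, ← hwy]
    exact hw
  have hFm : Measurable (fun v : sphere (0 : EuclideanSpace ℝ (Fin N)) 1 => surfaceMeasure N
      (Prod.mk v ⁻¹' ((fun p : sphere (0 : EuclideanSpace ℝ (Fin N)) 1 ×
      sphere (0 : EuclideanSpace ℝ (Fin N)) 1 =>
      ε • (p.1 : EuclideanSpace ℝ (Fin N)) + ε • (p.2 : EuclideanSpace ℝ (Fin N))) ⁻¹' T))) :=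
    measurable_measure_prodMk_left (hmeas hTm)
  rw [Filter.EventuallyEq, ae_iff]
  refine toSphere_eq_zero_of_direction_null _ (hFm (measurableSet_singleton _).compl)
    (measure_mono_null ?_ h2)
  rintro y ⟨v, hv, hvy⟩ hy
  apply hv
  simp only [Set.mem_ofPred_eq, ← hvy] at hy
  exact hy

/-- The surface measure is invariant under the antipodal map. -/
theorem measurePreserving_neg_surfaceMeasure (N : ℕ) :
    MeasurePreserving (fun v : sphere (0 : EuclideanSpace ℝ (Fin N)) 1 => -v)
      (surfaceMeasure N) (surfaceMeasure N) := by
  have hm : Measurable (fun v : sphere (0 : EuclideanSpace ℝ (Fin N)) 1 => -v) :=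
    continuous_neg.measurable
  refine ⟨hm, Measure.ext fun s hs => ?_⟩
  rw [Measure.map_apply hm hs]
  unfold surfaceMeasure
  rw [Measure.toSphere_apply' _ (hm hs), Measure.toSphere_apply' _ hs]
  congr 1
  rw [← Measure.measure_neg volume (Set.Ioo (0 : ℝ) 1 • (Subtype.val '' s))]
  congr 1
  ext x
  rw [Set.mem_neg]
  constructor
  · rintro ⟨r, hr, _, ⟨v, hv, rfl⟩, rfl⟩
    exact ⟨r, hr, _, ⟨-v, hv, rfl⟩, by simp⟩
  · rintro ⟨r, hr, _, ⟨v, hv, rfl⟩, hx⟩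
    refine ⟨r, hr, _, ⟨-v, ?_, rfl⟩, ?_⟩
    · simpa using hv
    · rw [← neg_neg x, ← hx]; simp

/-! ### One-sided bounds from propagation of large values. -/

/-- A Borel function whose large values propagate to a definite fraction of the surrounding sphere,
and which is nonpositive outside a bounded set, is bounded above. -/
theorem bddAbove_of_large_values_propagate {N : ℕ} (hN : 2 ≤ N) {ε : ℝ} (hε : 0 < ε)
    {Ω : Set (EuclideanSpace ℝ (Fin N))} (hΩ : Bornology.IsBounded Ω)
    {g : EuclideanSpace ℝ (Fin N) → ℝ} (hg : Measurable g) (hout : ∀ x, x ∉ Ω → g x ≤ 0)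
    {c : ℝ≥0∞} (hc : c ≠ 0) {κ : ℝ} (hκ : 0 ≤ κ)
    (hprop : ∀ L : ℝ, ∀ x ∈ Ω, L + κ < g x →
      c ≤ surfaceMeasure N {v | L < g (x + ε • (v : EuclideanSpace ℝ (Fin N)))}) :
    ∃ C, ∀ x, g x ≤ C := by
  by_contra! hunb
  set ν := ((surfaceMeasure N).prod (surfaceMeasure N)).map
      (fun p => ε • (p.1 : EuclideanSpace ℝ (Fin N)) + ε • (p.2 : EuclideanSpace ℝ (Fin N))) with hν
  have hac : ν ≪ volume := map_sphere_add_absolutelyContinuous hN hε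
  have hlow : ∀ n : ℕ, ∃ x, c * c ≤ ν {z | (n : ℝ) < g (x + z)} := by
    intro n
    -- Each of the two steps costs one `κ`.
    obtain ⟨x, hx⟩ := hunb (n + κ + κ)
    have hnn : (0 : ℝ) ≤ n := n.cast_nonneg
    refine ⟨x, ?_⟩
    have hS : MeasurableSet {z | (n : ℝ) < g (x + z)} :=
      (hg.comp (measurable_const_add x)) measurableSet_Ioi
    have hmeas : Measurable (fun p : sphere (0 : EuclideanSpace ℝ (Fin N)) 1 ×
      sphere (0 : EuclideanSpace ℝ (Fin N)) 1 =>
      ε • (p.1 : EuclideanSpace ℝ (Fin N)) + ε • (p.2 : EuclideanSpace ℝ (Fin N))) := by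
      fun_prop
    rw [hν, Measure.map_apply hmeas hS, Measure.prod_apply (hmeas hS)]
    have hin : ∀ y, ∀ t, 0 ≤ t → t < g y → y ∈ Ω := fun y t ht hy => by
      by_contra h
      linarith [hout y h]
    set A : Set (sphere (0 : EuclideanSpace ℝ (Fin N)) 1) :=
      {v | n + κ < g (x + ε • (v : EuclideanSpace ℝ (Fin N)))} with hA
    have hAm : MeasurableSet A :=
      (hg.comp (by fun_prop : Measurable (fun v : sphere (0 : EuclideanSpace ℝ (Fin N)) 1 =>
        x + ε • (v : EuclideanSpace ℝ (Fin N))))) measurableSet_Ioi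
    have hcA : c ≤ surfaceMeasure N A := hprop _ x (hin x _ (by positivity) hx) hx
    calc c * c ≤ c * surfaceMeasure N A := by gcongr
      _ = ∫⁻ _ in A, c ∂(surfaceMeasure N) := by rw [setLIntegral_const]
      _ ≤ ∫⁻ v in A, surfaceMeasure N (Prod.mk v ⁻¹'
          ((fun p : sphere (0 : EuclideanSpace ℝ (Fin N)) 1 ×
          sphere (0 : EuclideanSpace ℝ (Fin N)) 1 => ε • (p.1 : EuclideanSpace ℝ (Fin N)) +
          ε • (p.2 : EuclideanSpace ℝ (Fin N))) ⁻¹' {z | (n : ℝ) < g (x + z)}))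
          ∂(surfaceMeasure N) := by
        refine setLIntegral_mono' hAm fun v hv => ?_
        refine (hprop n _ (hin _ _ (by positivity) hv) hv).trans (measure_mono fun w hw => ?_)
        simpa [add_assoc] using hw
      _ ≤ _ := setLIntegral_le_lintegral _ _
  have hcc : c * c ≠ 0 := mul_ne_zero hc hc
  have hfin : IsFiniteMeasure ν := by rw [hν]; infer_instance
  -- The density of `ν` is integrable, so sets of small volume have small `ν`-mass wherever they
  -- lie; this matters because `x` depends on `n`.
  obtain ⟨η, hη, hsmall⟩ := exists_pos_setLIntegral_lt_of_measure_lt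
    (μ := (volume : Measure (EuclideanSpace ℝ (Fin N))))
    (f := ν.rnDeriv volume) (Measure.lintegral_rnDeriv_lt_top ν volume).ne hcc
  have htend : Filter.Tendsto (fun n : ℕ => volume {z | (n : ℝ) < g z}) Filter.atTop (𝓝 0) := by
    have hempty : (⋂ n : ℕ, {z | (n : ℝ) < g z}) = ∅ := by
      ext z
      simp only [Set.mem_iInter, Set.mem_ofPred_eq, Set.mem_empty_iff_false, iff_false, not_forall,
        not_lt]
      exact exists_nat_ge (g z)
    rw [← measure_empty (μ := (volume : Measure (EuclideanSpace ℝ (Fin N)))), ← hempty]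
    refine tendsto_measure_iInter_atTop (fun n => (hg measurableSet_Ioi).nullMeasurableSet)
      (fun m n hmn z (hz : (n : ℝ) < g z) => show (m : ℝ) < g z from
        lt_of_le_of_lt (Nat.cast_le.2 hmn) hz) ⟨0, ?_⟩
    refine ((measure_mono fun z hz => ?_).trans_lt hΩ.measure_lt_top).ne
    by_contra h
    simp only [Nat.cast_zero, Set.mem_ofPred_eq] at hz
    linarith [hout z h]
  obtain ⟨n, hn⟩ := (htend.eventually (gt_mem_nhds hη)).exists
  obtain ⟨x, hx⟩ := hlow n
  have hvol : volume {z | (n : ℝ) < g (x + z)} = volume {z | (n : ℝ) < g z} :=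
    measure_preimage_add volume x {z | (n : ℝ) < g z}
  have := hsmall {z | (n : ℝ) < g (x + z)} (hvol ▸ hn)
  rw [Measure.setLIntegral_rnDeriv hac] at this
  exact absurd hx this.not_ge

/-! ### Sup-inf of bounded families. -/

section SupInf

variable {ι κ : Type*} {F G : ι → κ → ℝ} {C m : ℝ}

theorem bddBelow_range_of_abs_le {f : κ → ℝ} (h : ∀ j, |f j| ≤ C) : BddBelow (Set.range f) :=
  ⟨-C, by rintro _ ⟨j, rfl⟩; exact (abs_le.1 (h j)).1⟩

theorem bddAbove_range_iInf_of_abs_le [Nonempty κ] (hF : ∀ i j, |F i j| ≤ C) :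
    BddAbove (Set.range fun i => ⨅ j, F i j) := by
  refine ⟨C, ?_⟩
  rintro _ ⟨i, rfl⟩
  exact (ciInf_le (bddBelow_range_of_abs_le (hF i)) (Classical.arbitrary κ)).trans
    (abs_le.1 (hF i _)).2

theorem iSup_iInf_le_iSup_iInf_add [Nonempty ι] [Nonempty κ] (hF : ∀ i j, |F i j| ≤ C) (hG : ∀ i j, |G i j| ≤ C)
    (h : ∀ i j, F i j ≤ G i j + m) : ⨆ i, ⨅ j, F i j ≤ (⨆ i, ⨅ j, G i j) + m := by
  refine ciSup_le fun i => ?_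
  have h1 : ⨅ j, F i j ≤ (⨅ j, G i j) + m := by
    rw [← sub_le_iff_le_add]
    refine le_ciInf fun j => ?_
    rw [sub_le_iff_le_add]
    exact (ciInf_le (bddBelow_range_of_abs_le (hF i)) j).trans (h i j)
  exact h1.trans (add_le_add_left (le_ciSup (bddAbove_range_iInf_of_abs_le hG) i) m)

/-- A sup-inf may be computed along a sequence that approximates both arguments uniformly. -/
theorem iSup_iInf_eq_of_approx [Nonempty ι] {F : ι → ι → ℝ} (D : ℕ → ι) (hF : ∀ i j, |F i j| ≤ C)
    (hD : ∀ i, ∀ η > 0, ∃ n, ∀ j, |F i j - F (D n) j| ≤ η ∧ |F j i - F j (D n)| ≤ η) :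
    ⨆ i, ⨅ j, F i j = ⨆ n, ⨅ k, F (D n) (D k) := by
  have hb (i : ι) := bddBelow_range_of_abs_le (hF i)
  have hb' (i : ι) : BddBelow (Set.range fun k => F i (D k)) :=
    bddBelow_range_of_abs_le fun k => hF i (D k)
  apply le_antisymm
  · refine le_of_forall_pos_le_add fun η hη => ciSup_le fun i => ?_
    obtain ⟨n, hn⟩ := hD i η hη
    have h1 : ⨅ j, F i j ≤ (⨅ k, F (D n) (D k)) + η := by
      rw [← sub_le_iff_le_add]
      refine le_ciInf fun k => ?_
      linarith [ciInf_le (hb i) (D k), (abs_le.1 (hn (D k)).1).2]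
    exact h1.trans (add_le_add_left (le_ciSup
      (bddAbove_range_iInf_of_abs_le fun n k => hF (D n) (D k)) n) η)
  · refine ciSup_le fun n => le_trans ?_ (le_ciSup (bddAbove_range_iInf_of_abs_le hF) (D n))
    refine le_ciInf fun j => le_of_forall_pos_le_add fun η hη => ?_
    obtain ⟨k, hk⟩ := hD j η hη
    linarith [ciInf_le (hb' (D n)) k, (abs_le.1 (hk (D n)).2).1]

end SupInf

/-! ### Stability of averages in the function and in the set. -/

section Average

variable {α : Type*} [MeasurableSpace α] {μ : Measure α}

theorem setAverage_le_of_le [IsFiniteMeasure μ] {f : α → ℝ} {s : Set α} {a : ℝ} (hs : MeasurableSet s)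
    (hpos : 0 < μ.real s) (hf : Integrable f μ) (h : ∀ v ∈ s, f v ≤ a) :
    ⨍ v in s, f v ∂μ ≤ a := by
  rw [setAverage_eq, smul_eq_mul, inv_mul_le_iff₀ hpos]
  have := setIntegral_mono_on hf.integrableOn (integrableOn_const (C := a) (by finiteness)) hs h
  simpa using this

theorem le_setAverage_of_le [IsFiniteMeasure μ] {f : α → ℝ} {s : Set α} {a : ℝ} (hs : MeasurableSet s)
    (hpos : 0 < μ.real s) (hf : Integrable f μ) (h : ∀ v ∈ s, a ≤ f v) :
    a ≤ ⨍ v in s, f v ∂μ := by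
  rw [setAverage_eq, smul_eq_mul, le_inv_mul_iff₀ hpos]
  have := setIntegral_mono_on (integrableOn_const (C := a) (by finiteness)) hf.integrableOn hs h
  simpa using this

theorem abs_setAverage_sub_le {f g : α → ℝ} {s : Set α} {d : ℝ} (hd : 0 < d)
    (hs : d ≤ μ.real s) (hf : Integrable f μ) (hg : Integrable g μ) :
    |(⨍ v in s, f v ∂μ) - ⨍ v in s, g v ∂μ| ≤ (∫ v, |f v - g v| ∂μ) / d := by
  rw [setAverage_eq, setAverage_eq, ← smul_sub, ← integral_sub hf.integrableOn hg.integrableOn,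
    smul_eq_mul, abs_mul, abs_of_nonneg (inv_nonneg.2 measureReal_nonneg), div_eq_inv_mul]
  gcongr
  calc |∫ v in s, f v - g v ∂μ| ≤ ∫ v in s, |f v - g v| ∂μ := abs_integral_le_integral_abs
    _ ≤ ∫ v, |f v - g v| ∂μ :=
      setIntegral_le_integral (hf.sub hg).abs (Filter.Eventually.of_forall fun _ => abs_nonneg _)

theorem abs_setAverage_le {f : α → ℝ} {s : Set α} {d : ℝ} (hd : 0 < d)
    (hs : d ≤ μ.real s) (hf : Integrable f μ) :
    |⨍ v in s, f v ∂μ| ≤ (∫ v, |f v| ∂μ) / d := by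
  simpa [setAverage_eq] using abs_setAverage_sub_le hd hs hf (integrable_zero α ℝ μ)

theorem abs_setIntegral_sub_setIntegral_le [IsFiniteMeasure μ] {f : α → ℝ} {s t : Set α} {C : ℝ}
    (hs : MeasurableSet s) (ht : MeasurableSet t) (hf : Integrable f μ) (hC : ∀ v, |f v| ≤ C) :
    |(∫ v in s, f v ∂μ) - ∫ v in t, f v ∂μ| ≤ C * μ.real (symmDiff s t) := by
  have h1 := integral_inter_add_sdiff ht hf.integrableOn (s := s) (f := f)
  have h2 := integral_inter_add_sdiff hs hf.integrableOn (s := t) (f := f)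
  have h3 : |∫ v in s \ t, f v ∂μ| ≤ C * μ.real (s \ t) :=
    norm_setIntegral_le_of_norm_le_const (f := f) (measure_lt_top μ _) fun v _ => hC v
  have h4 : |∫ v in t \ s, f v ∂μ| ≤ C * μ.real (t \ s) :=
    norm_setIntegral_le_of_norm_le_const (f := f) (measure_lt_top μ _) fun v _ => hC v
  have h5 : μ.real (symmDiff s t) = μ.real (s \ t) + μ.real (t \ s) :=
    measureReal_union disjoint_sdiff_sdiff (ht.diff hs)
  rw [← h1, ← h2, Set.inter_comm t s, h5, add_sub_add_left_eq_sub, mul_add]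
  exact (abs_sub _ _).trans (add_le_add h3 h4)

/-- Changing the set perturbs the integral and the normalization; each contributes at most `C / d`
times the measure of the symmetric difference. -/
theorem abs_setAverage_sub_setAverage_le [IsFiniteMeasure μ] {f : α → ℝ} {s t : Set α} {C d : ℝ} (hd : 0 < d)
    (hs : MeasurableSet s) (ht : MeasurableSet t) (hsd : d ≤ μ.real s) (htd : d ≤ μ.real t)
    (hf : Integrable f μ) (hC : ∀ v, |f v| ≤ C) (hC0 : 0 ≤ C) :
    |(⨍ v in s, f v ∂μ) - ⨍ v in t, f v ∂μ| ≤ 2 * C / d * μ.real (symmDiff s t) := by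
  have h1 := abs_setIntegral_sub_setIntegral_le hs ht hf hC
  have h2 := abs_setIntegral_sub_setIntegral_le ht hs (integrable_const (1 : ℝ) (μ := μ))
    (C := 1) (by simp)
  have h3 : |∫ v in t, f v ∂μ| ≤ C * μ.real t :=
    norm_setIntegral_le_of_norm_le_const (f := f) (measure_lt_top μ _) fun v _ => hC v
  rw [symmDiff_comm t s] at h2
  simp only [integral_const, measureReal_restrict_apply_univ, smul_eq_mul, mul_one, one_mul] at h2
  rw [setAverage_eq, setAverage_eq, smul_eq_mul, smul_eq_mul]
  set a := ∫ v in s, f v ∂μ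
  set b := ∫ v in t, f v ∂μ
  set p := μ.real s
  set q := μ.real t
  set η := μ.real (symmDiff s t)
  have hp : 0 < p := hd.trans_le hsd
  have hq : 0 < q := hd.trans_le htd
  have hη : 0 ≤ η := measureReal_nonneg
  have e : p⁻¹ * a - q⁻¹ * b = p⁻¹ * ((a - b) + q⁻¹ * (b * (q - p))) := by
    field_simp
    ring
  have h4 : |q⁻¹ * (b * (q - p))| ≤ C * η := by
    rw [abs_mul, abs_mul, abs_of_pos (inv_pos.2 hq), inv_mul_le_iff₀ hq]
    calc |b| * |q - p| ≤ (C * q) * η := by gcongr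
      _ = q * (C * η) := by ring
  have h5 : |(a - b) + q⁻¹ * (b * (q - p))| ≤ 2 * C * η := by
    refine (abs_add_le _ _).trans ?_
    linarith
  rw [e, abs_mul, abs_of_pos (inv_pos.2 hp)]
  calc p⁻¹ * |(a - b) + q⁻¹ * (b * (q - p))| ≤ d⁻¹ * (2 * C * η) := by gcongr
    _ = 2 * C / d * η := by ring

end Average

/-! ### The one-round game on the sphere. -/

/-- The value of the one-round game with payoff `f` on the sphere. -/
noncomputable def gameValue {N : ℕ} (δ : ℝ) (f : sphere (0 : EuclideanSpace ℝ (Fin N)) 1 → ℝ) : ℝ :=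
  ⨆ A : admissibleSets N δ, ⨅ B : admissibleSets N δ,
    ⨍ v in (A : Set (sphere (0 : EuclideanSpace ℝ (Fin N)) 1)) ∩ B, f v ∂(surfaceMeasure N)

theorem gameOperator_eq_gameValue {N : ℕ} (ε δ : ℝ) (u : EuclideanSpace ℝ (Fin N) → ℝ)
    (x : EuclideanSpace ℝ (Fin N)) :
    gameOperator ε δ u x = gameValue δ fun v : sphere (0 : EuclideanSpace ℝ (Fin N)) 1 =>
      u (x + ε • (v : EuclideanSpace ℝ (Fin N))) := rfl

section GameValue

variable {N : ℕ} {δ : ℝ} {f g : sphere (0 : EuclideanSpace ℝ (Fin N)) 1 → ℝ}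

/-- Inclusion-exclusion. This uniform bound keeps the denominators of all averages away from zero.
-/
theorem two_mul_le_measureReal_inter {A B : Set (sphere (0 : EuclideanSpace ℝ (Fin N)) 1)}
    (hA : A ∈ admissibleSets N δ) (hB : B ∈ admissibleSets N δ) :
    2 * δ ≤ (surfaceMeasure N).real (A ∩ B) := by
  have h1 := measureReal_union_add_inter (μ := surfaceMeasure N) (s := A) hB.1
  have h2 := measureReal_mono (μ := surfaceMeasure N) (Set.subset_univ (A ∪ B))
  linarith [hA.2, hB.2]

theorem nonempty_admissibleSets (hδ' : δ < (1 / 2) * (surfaceMeasure N).real Set.univ) :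
    Nonempty (admissibleSets N δ) :=
  ⟨⟨Set.univ, MeasurableSet.univ, by linarith⟩⟩

theorem abs_average_admissible_le (hδ : 0 < δ) (hf : Integrable f (surfaceMeasure N))
    (A B : admissibleSets N δ) :
    |⨍ v in (A : Set (sphere (0 : EuclideanSpace ℝ (Fin N)) 1)) ∩ B, f v ∂(surfaceMeasure N)| ≤
      (∫ v, |f v| ∂(surfaceMeasure N)) / (2 * δ) :=
  abs_setAverage_le (by positivity) (two_mul_le_measureReal_inter A.2 B.2) hf

theorem gameValue_le_add (hδ : 0 < δ) (hδ' : δ < (1 / 2) * (surfaceMeasure N).real Set.univ)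
    (hf : Integrable f (surfaceMeasure N)) (hg : Integrable g (surfaceMeasure N)) {m : ℝ}
    (h : ∀ A B : admissibleSets N δ,
      ⨍ v in (A : Set (sphere (0 : EuclideanSpace ℝ (Fin N)) 1)) ∩ B, f v ∂(surfaceMeasure N) ≤
      (⨍ v in (A : Set (sphere (0 : EuclideanSpace ℝ (Fin N)) 1)) ∩ B, g v ∂(surfaceMeasure N))
        + m) :
    gameValue δ f ≤ gameValue δ g + m := by
  have := nonempty_admissibleSets hδ'
  exact iSup_iInf_le_iSup_iInf_add
    (fun A B => (abs_average_admissible_le hδ hf A B).trans (le_max_left _ _))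
    (fun A B => (abs_average_admissible_le hδ hg A B).trans (le_max_right _ _)) h

theorem gameValue_le_add_of_le (hδ : 0 < δ)
    (hδ' : δ < (1 / 2) * (surfaceMeasure N).real Set.univ)
    (hf : Integrable f (surfaceMeasure N)) (hg : Integrable g (surfaceMeasure N)) {m : ℝ}
    (h : ∀ v, f v ≤ g v + m) : gameValue δ f ≤ gameValue δ g + m := by
  refine gameValue_le_add hδ hδ' hf hg fun A B => ?_
  have hpos : 0 < (surfaceMeasure N).real (A.1 ∩ B.1) := by
    linarith [two_mul_le_measureReal_inter A.2 B.2]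
  have h1 := setAverage_le_of_le (A.2.1.inter B.2.1) hpos (hf.sub hg) (a := m)
    fun v _ => by simpa using sub_le_iff_le_add'.2 (h v)
  rw [setAverage_eq, smul_eq_mul] at h1 ⊢
  rw [setAverage_eq, smul_eq_mul]
  simp only [Pi.sub_apply] at h1
  rw [integral_sub hf.integrableOn hg.integrableOn, mul_sub] at h1
  linarith

theorem abs_gameValue_sub_le (hδ : 0 < δ) (hδ' : δ < (1 / 2) * (surfaceMeasure N).real Set.univ)
    (hf : Integrable f (surfaceMeasure N)) (hg : Integrable g (surfaceMeasure N)) :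
    |gameValue δ f - gameValue δ g| ≤ (∫ v, |f v - g v| ∂(surfaceMeasure N)) / (2 * δ) := by
  have key (A B : admissibleSets N δ) := abs_setAverage_sub_le (by positivity)
    (two_mul_le_measureReal_inter A.2 B.2) hf hg
  rw [abs_sub_le_iff]
  constructor
  · rw [sub_le_iff_le_add']
    exact gameValue_le_add hδ hδ' hf hg fun A B => by linarith [(abs_le.1 (key A B)).2]
  · rw [sub_le_iff_le_add']
    exact gameValue_le_add hδ hδ' hg hf fun A B => by linarith [(abs_le.1 (key A B)).1]

theorem gameValue_const_mul {r : ℝ} (hr : 0 ≤ r) :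
    gameValue δ (fun v => r * f v) = r * gameValue δ f := by
  unfold gameValue
  rw [Real.mul_iSup_of_nonneg hr]
  congr 1 with A
  rw [Real.mul_iInf_of_nonneg hr]
  congr 1 with B
  rw [setAverage_eq, setAverage_eq, integral_const_mul, smul_eq_mul, smul_eq_mul]
  ring

/-- Were the superlevel set smaller, its complement would be an admissible `B` keeping every average
at most `L`. -/
theorem le_measure_lt_of_lt_gameValue (hδ : 0 < δ)
    (hδ' : δ < (1 / 2) * (surfaceMeasure N).real Set.univ) (hfm : Measurable f)
    (hf : Integrable f (surfaceMeasure N)) {L : ℝ} (hL : L < gameValue δ f) :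
    ENNReal.ofReal ((1 / 2) * (surfaceMeasure N).real Set.univ - δ) ≤
      surfaceMeasure N {v | L < f v} := by
  by_contra! hlt
  have := nonempty_admissibleSets hδ'
  have hm : MeasurableSet {v | L < f v} := hfm measurableSet_Ioi
  have h1 : (surfaceMeasure N).real {v | L < f v} <
      (1 / 2) * (surfaceMeasure N).real Set.univ - δ := by
    rw [measureReal_def]
    exact (ENNReal.lt_ofReal_iff_toReal_lt (by finiteness)).1 hlt
  have hB : {v | L < f v}ᶜ ∈ admissibleSets N δ := by
    refine ⟨hm.compl, ?_⟩
    rw [measureReal_compl hm]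
    linarith
  obtain ⟨A, hA⟩ := exists_lt_of_lt_ciSup hL
  have h2 := ciInf_le (bddBelow_range_of_abs_le fun B => abs_average_admissible_le hδ hf A B) ⟨_, hB⟩
  have h3 := setAverage_le_of_le (A.2.1.inter hm.compl)
    (by linarith [two_mul_le_measureReal_inter A.2 hB]) hf (a := L) fun v hv => not_lt.1 hv.2
  exact absurd (hA.trans_le (h2.trans h3)) (lt_irrefl _)

/-- The mirror argument: the maximizing player would choose `{v | L ≤ f v}`. -/
theorem le_measure_lt_of_gameValue_lt (hδ : 0 < δ)
    (hδ' : δ < (1 / 2) * (surfaceMeasure N).real Set.univ) (hfm : Measurable f)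
    (hf : Integrable f (surfaceMeasure N)) {L : ℝ} (hL : gameValue δ f < L) :
    ENNReal.ofReal ((1 / 2) * (surfaceMeasure N).real Set.univ - δ) ≤
      surfaceMeasure N {v | f v < L} := by
  by_contra! hlt
  have := nonempty_admissibleSets hδ'
  have hm : MeasurableSet {v | f v < L} := hfm measurableSet_Iio
  have h1 : (surfaceMeasure N).real {v | f v < L} <
      (1 / 2) * (surfaceMeasure N).real Set.univ - δ := by
    rw [measureReal_def]
    exact (ENNReal.lt_ofReal_iff_toReal_lt (by finiteness)).1 hlt
  have hA : {v | f v < L}ᶜ ∈ admissibleSets N δ := by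
    refine ⟨hm.compl, ?_⟩
    rw [measureReal_compl hm]
    linarith
  have h2 := le_ciSup (bddAbove_range_iInf_of_abs_le fun A B =>
    abs_average_admissible_le hδ hf A B) (⟨_, hA⟩ : admissibleSets N δ)
  refine absurd (lt_of_le_of_lt (le_trans (le_ciInf fun B => ?_) h2) hL) (lt_irrefl _)
  exact le_setAverage_of_le (hm.compl.inter B.2.1)
    (by linarith [two_mul_le_measureReal_inter hA B.2]) hf fun v hv => not_lt.1 hv.1

/-- Answering `A` by its antipodal image bounds the value of a payoff which is antisymmetric up to a
constant. -/
theorem gameValue_le_of_add_neg_eq (hδ : 0 < δ)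
    (hδ' : δ < (1 / 2) * (surfaceMeasure N).real Set.univ)
    (hf : Integrable f (surfaceMeasure N)) {a : ℝ} (h : ∀ v, f v + f (-v) = 2 * a) :
    gameValue δ f ≤ a := by
  have := nonempty_admissibleSets hδ'
  have hneg := measurePreserving_neg_surfaceMeasure N
  refine ciSup_le fun A => ?_
  have hB : (fun v => -v) ⁻¹' (A : Set (sphere (0 : EuclideanSpace ℝ (Fin N)) 1)) ∈
      admissibleSets N δ := by
    refine ⟨hneg.measurable A.2.1, ?_⟩
    rw [hneg.measureReal_preimage A.2.1.nullMeasurableSet]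
    exact A.2.2
  refine (ciInf_le (bddBelow_range_of_abs_le fun B => abs_average_admissible_le hδ hf A B)
    ⟨_, hB⟩).trans_eq ?_
  -- The set `s` is antipodally symmetric, so `f v` and `f (-v)` have the same average over it,
  -- namely `a`.
  set s := (A : Set (sphere (0 : EuclideanSpace ℝ (Fin N)) 1)) ∩ (fun v => -v) ⁻¹' A.1 with hs
  have hpos : 0 < (surfaceMeasure N).real s := by
    linarith [two_mul_le_measureReal_inter A.2 hB]
  have hsymm : (fun v => -v) ⁻¹' s = s := by
    ext v
    simp [hs, and_comm]
  have hemb : MeasurableEmbedding (fun v : sphere (0 : EuclideanSpace ℝ (Fin N)) 1 => -v) :=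
    (Homeomorph.neg _).measurableEmbedding
  have h1 : ∫ v in s, f (-v) ∂(surfaceMeasure N) = ∫ v in s, f v ∂(surfaceMeasure N) := by
    have := hneg.setIntegral_preimage_emb hemb f s
    rwa [hsymm] at this
  have h2 : ∫ v in s, (f v + f (-v)) ∂(surfaceMeasure N) =
      (surfaceMeasure N).real s * (2 * a) := by
    simp only [h, integral_const, measureReal_restrict_apply_univ, smul_eq_mul]
  have hf' : Integrable (fun v => f (-v)) (surfaceMeasure N) := hneg.integrable_comp_of_integrable hf
  rw [integral_add hf.integrableOn hf'.integrableOn, h1] at h2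
  rw [setAverage_eq, smul_eq_mul, inv_mul_eq_iff_eq_mul₀ hpos.ne']
  linarith

/-- The admissible sets are separable for the measure of the symmetric difference. -/
theorem exists_dense_seq_admissibleSets (hδ' : δ < (1 / 2) * (surfaceMeasure N).real Set.univ) :
    ∃ D : ℕ → admissibleSets N δ, ∀ A : admissibleSets N δ, ∀ η > 0, ∃ n,
      (surfaceMeasure N).real (symmDiff A.1 (D n).1) < η := by
  have := nonempty_admissibleSets hδ'
  -- The measure of the symmetric difference is the `L¹` distance of indicators, and `L¹` is
  -- separable.
  let Φ : admissibleSets N δ → Lp ℝ 1 (surfaceMeasure N) := fun A =>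
    indicatorConstLp 1 A.2.1 (by finiteness) (1 : ℝ)
  have : Fact ((1 : ℝ≥0∞) ≠ ∞) := ⟨by simp⟩
  have : IsSeparable (surfaceMeasure N) := inferInstance
  have : SecondCountableTopology (Lp ℝ 1 (surfaceMeasure N)) := inferInstance
  have : Nonempty (Set.range Φ) := (Set.range_nonempty Φ).to_subtype
  obtain ⟨d, hd⟩ := TopologicalSpace.exists_dense_seq (Set.range Φ)
  choose D hD using fun n => (d n).2
  refine ⟨D, fun A η hη => ?_⟩
  obtain ⟨n, hn⟩ := hd.exists_dist_lt ⟨Φ A, A, rfl⟩ hη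
  refine ⟨n, ?_⟩
  rw [Subtype.dist_eq, ← hD, dist_indicatorConstLp_eq_norm, norm_indicatorConstLp (by simp)
    (by simp)] at hn
  simpa using hn

theorem gameValue_eq_of_dense (hδ : 0 < δ) {D : ℕ → admissibleSets N δ}
    (hδ' : δ < (1 / 2) * (surfaceMeasure N).real Set.univ)
    (hD : ∀ A : admissibleSets N δ, ∀ η > 0, ∃ n,
      (surfaceMeasure N).real (symmDiff A.1 (D n).1) < η)
    (hf : Integrable f (surfaceMeasure N)) {C : ℝ} (hC0 : 0 < C) (hC : ∀ v, |f v| ≤ C) :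
    gameValue δ f = ⨆ n, ⨅ k, ⨍ v in (D n).1 ∩ (D k).1, f v ∂(surfaceMeasure N) := by
  have := nonempty_admissibleSets hδ'
  refine iSup_iInf_eq_of_approx (F := fun A B : admissibleSets N δ =>
    ⨍ v in A.1 ∩ B.1, f v ∂(surfaceMeasure N)) D (abs_average_admissible_le hδ hf)
    fun A η hη => ?_
  -- The divisor is the Lipschitz constant of the average with respect to the symmetric difference,
  -- with `d = 2 * δ`.
  obtain ⟨n, hn⟩ := hD A (η / (2 * C / (2 * δ))) (by positivity)
  have key : ∀ B : admissibleSets N δ, |(⨍ v in A.1 ∩ B.1, f v ∂(surfaceMeasure N)) -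
      ⨍ v in (D n).1 ∩ B.1, f v ∂(surfaceMeasure N)| ≤ η := by
    intro B
    refine (abs_setAverage_sub_setAverage_le (d := 2 * δ) (by positivity) (A.2.1.inter B.2.1)
      ((D n).2.1.inter B.2.1) (two_mul_le_measureReal_inter A.2 B.2)
      (two_mul_le_measureReal_inter (D n).2 B.2) hf hC hC0.le).trans ?_
    have hmono : (surfaceMeasure N).real (symmDiff (A.1 ∩ B.1) ((D n).1 ∩ B.1)) ≤
        (surfaceMeasure N).real (symmDiff A.1 (D n).1) := by
      refine measureReal_mono fun v hv => ?_
      rw [Set.mem_symmDiff] at hv ⊢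
      simp only [Set.mem_inter_iff] at hv
      tauto
    rw [← le_div_iff₀' (by positivity)]
    exact hmono.trans hn.le
  refine ⟨n, fun B => ⟨key B, ?_⟩⟩
  simpa only [Set.inter_comm] using key B

end GameValue

/-! ### Integrability and Borel measurability for bounded functions. -/

theorem integrable_sphere_of_abs_le {N : ℕ} {u : EuclideanSpace ℝ (Fin N) → ℝ}
    (hu : Measurable u) {C : ℝ} (hC : ∀ x, |u x| ≤ C) (ε : ℝ) (x : EuclideanSpace ℝ (Fin N)) :
    Integrable (fun v : sphere (0 : EuclideanSpace ℝ (Fin N)) 1 =>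
      u (x + ε • (v : EuclideanSpace ℝ (Fin N)))) (surfaceMeasure N) := by
  have hm : Measurable (fun v : sphere (0 : EuclideanSpace ℝ (Fin N)) 1 =>
    x + ε • (v : EuclideanSpace ℝ (Fin N))) := by fun_prop
  exact Integrable.of_bound (hu.comp hm).aestronglyMeasurable C
    (Filter.Eventually.of_forall fun v => hC _)

/-- The game operator preserves Borel measurability of bounded functions. -/
theorem measurable_gameOperator {N : ℕ} {ε δ : ℝ} (hδ : 0 < δ)
    (hδ' : δ < (1 / 2) * (surfaceMeasure N).real Set.univ) {u : EuclideanSpace ℝ (Fin N) → ℝ}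
    (hu : Measurable u) {C : ℝ} (hC0 : 0 < C) (hC : ∀ x, |u x| ≤ C) :
    Measurable (gameOperator ε δ u) := by
  obtain ⟨D, hD⟩ := exists_dense_seq_admissibleSets hδ'
  have heq : gameOperator ε δ u = fun x => ⨆ n, ⨅ k, ⨍ v in (D n).1 ∩ (D k).1,
      u (x + ε • (v : EuclideanSpace ℝ (Fin N))) ∂(surfaceMeasure N) := by
    funext x
    exact gameValue_eq_of_dense hδ hδ' hD (integrable_sphere_of_abs_le hu hC ε x) hC0
      fun v => hC _
  rw [heq]
  refine Measurable.iSup fun n => Measurable.iInf fun k => ?_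
  simp only [setAverage_eq, smul_eq_mul]
  have hm : Measurable (fun p : EuclideanSpace ℝ (Fin N) ×
    sphere (0 : EuclideanSpace ℝ (Fin N)) 1 => p.1 + ε • (p.2 : EuclideanSpace ℝ (Fin N))) := by
    fun_prop
  have hint := ((hu.comp hm).stronglyMeasurable.integral_prod_right'
    (ν := (surfaceMeasure N).restrict ((D n).1 ∩ (D k).1))).measurable
  exact hint.const_mul _

/-! ### One-sided bounds and the comparison principle. -/

section Comparison

variable {N : ℕ} {Ω : Set (EuclideanSpace ℝ (Fin N))} {ε δ K : ℝ}

theorem IsDPPFunction.measurable_sphere {u : EuclideanSpace ℝ (Fin N) → ℝ}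
    (hu : IsDPPFunction Ω ε u) (x : EuclideanSpace ℝ (Fin N)) :
    Measurable (fun v : sphere (0 : EuclideanSpace ℝ (Fin N)) 1 =>
      u (x + ε • (v : EuclideanSpace ℝ (Fin N)))) := by
  have hm : Measurable (fun v : sphere (0 : EuclideanSpace ℝ (Fin N)) 1 =>
    x + ε • (v : EuclideanSpace ℝ (Fin N))) := by fun_prop
  exact hu.measurable.comp hm

theorem IsDPPSubsolution.exists_le (hN : 2 ≤ N) (hΩ : Bornology.IsBounded Ω) (hε : 0 < ε)
    (hδ : 0 < δ) (hδ' : δ < (1 / 2) * (surfaceMeasure N).real Set.univ) (hK : 0 < K)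
    {u : EuclideanSpace ℝ (Fin N) → ℝ} (hu : IsDPPSubsolution Ω ε δ K u) :
    ∃ C, ∀ x, u x ≤ C := by
  refine bddAbove_of_large_values_propagate hN hε hΩ hu.measurable hu.le_outside
    (c := ENNReal.ofReal ((1 / 2) * (surfaceMeasure N).real Set.univ - δ)) (κ := ε ^ 2 * K)
    (by simpa using hδ') (by positivity) fun L x hx hL => ?_
  refine le_measure_lt_of_lt_gameValue hδ hδ' (hu.measurable_sphere x) (hu.integrable x hx) ?_
  have := hu.le_inside x hx
  rw [gameOperator_eq_gameValue] at this
  linarith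

/-- For `-u` the running payoff has the favourable sign, so the loss per step is `κ = 0`. -/
theorem IsDPPSupersolution.exists_neg_le (hN : 2 ≤ N) (hΩ : Bornology.IsBounded Ω) (hε : 0 < ε)
    (hδ : 0 < δ) (hδ' : δ < (1 / 2) * (surfaceMeasure N).real Set.univ) (hK : 0 < K)
    {u : EuclideanSpace ℝ (Fin N) → ℝ} (hu : IsDPPSupersolution Ω ε δ K u) :
    ∃ C, ∀ x, -u x ≤ C := by
  refine bddAbove_of_large_values_propagate hN hε hΩ hu.measurable.neg
    (fun x hx => neg_nonpos.2 (hu.ge_outside x hx))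
    (c := ENNReal.ofReal ((1 / 2) * (surfaceMeasure N).real Set.univ - δ)) (κ := 0)
    (by simpa using hδ') le_rfl fun L x hx hL => ?_
  simp only [lt_neg]
  refine le_measure_lt_of_gameValue_lt hδ hδ' (hu.measurable_sphere x) (hu.integrable x hx) ?_
  have := hu.ge_inside x hx
  rw [gameOperator_eq_gameValue] at this
  have : 0 < ε ^ 2 * K := by positivity
  linarith

/-- Subsolutions lie below strictly dilated supersolutions. -/
theorem IsDPPSubsolution.le_const_mul (hN : 2 ≤ N) (hΩ : Bornology.IsBounded Ω) (hε : 0 < ε)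
    (hδ : 0 < δ) (hδ' : δ < (1 / 2) * (surfaceMeasure N).real Set.univ) (hK : 0 < K)
    {uSuper uSub : EuclideanSpace ℝ (Fin N) → ℝ} (hsub : IsDPPSubsolution Ω ε δ K uSub)
    (hsuper : IsDPPSupersolution Ω ε δ K uSuper) {r : ℝ} (hr : 1 < r)
    (x : EuclideanSpace ℝ (Fin N)) : uSub x ≤ r * uSuper x := by
  obtain ⟨C₁, hC₁⟩ := hsub.exists_le hN hΩ hε hδ hδ' hK
  obtain ⟨C₂, hC₂⟩ := hsuper.exists_neg_le hN hΩ hε hδ hδ' hK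
  have hr0 : 0 < r := by linarith
  have hbdd : BddAbove (Set.range fun y => uSub y - r * uSuper y) := by
    refine ⟨C₁ + r * C₂, ?_⟩
    rintro _ ⟨y, rfl⟩
    have := mul_le_mul_of_nonneg_left (hC₂ y) hr0.le
    simp only
    linarith [hC₁ y]
  set m := ⨆ y, (uSub y - r * uSuper y) with hm
  have hle : ∀ y, uSub y - r * uSuper y ≤ m := fun y => le_ciSup hbdd y
  have hκ : 0 < (r - 1) * (ε ^ 2 * K) := mul_pos (by linarith) (by positivity)
  -- The supremum `m` need not be attained: the improved bound holds at every `y`, hence for `m`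
  -- itself.
  have hstep : ∀ y, uSub y - r * uSuper y ≤ max 0 (m - (r - 1) * (ε ^ 2 * K)) := by
    intro y
    by_cases hy : y ∈ Ω
    · refine le_max_of_le_right ?_
      have h1 := hsub.le_inside y hy
      have h2 := mul_le_mul_of_nonneg_left (hsuper.ge_inside y hy) hr0.le
      have h3 := gameValue_le_add_of_le hδ hδ' (hsub.integrable y hy)
        ((hsuper.integrable y hy).const_mul r) (m := m)
        fun v => by linarith [hle (y + ε • (v : EuclideanSpace ℝ (Fin N)))]
      rw [gameValue_const_mul hr0.le] at h3
      rw [gameOperator_eq_gameValue] at h1 h2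
      linarith
    · refine le_max_of_le_left ?_
      linarith [hsub.le_outside y hy, mul_nonneg hr0.le (hsuper.ge_outside y hy)]
  have hmle : m ≤ max 0 (m - (r - 1) * (ε ^ 2 * K)) := ciSup_le hstep
  have hm0 : m ≤ 0 := by
    rcases le_max_iff.1 hmle with h | h
    · exact h
    · linarith
  linarith [hle x]

theorem IsDPPSubsolution.le_supersolution (hN : 2 ≤ N) (hΩ : Bornology.IsBounded Ω) (hε : 0 < ε)
    (hδ : 0 < δ) (hδ' : δ < (1 / 2) * (surfaceMeasure N).real Set.univ) (hK : 0 < K)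
    {uSuper uSub : EuclideanSpace ℝ (Fin N) → ℝ} (hsub : IsDPPSubsolution Ω ε δ K uSub)
    (hsuper : IsDPPSupersolution Ω ε δ K uSuper) (x : EuclideanSpace ℝ (Fin N)) :
    uSub x ≤ uSuper x := by
  have hlim : Filter.Tendsto (fun r : ℝ => r * uSuper x) (𝓝[>] 1) (𝓝 (1 * uSuper x)) :=
    ((continuous_id.mul continuous_const).tendsto 1).mono_left nhdsWithin_le_nhds
  rw [one_mul] at hlim
  exact ge_of_tendsto hlim (eventually_nhdsWithin_of_forall fun r hr =>
    hsub.le_const_mul hN hΩ hε hδ hδ' hK hsuper hr x)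

theorem IsDPPSolution.isDPPSubsolution {u : EuclideanSpace ℝ (Fin N) → ℝ}
    (hu : IsDPPSolution Ω ε δ K u) : IsDPPSubsolution Ω ε δ K u :=
  ⟨hu.toIsDPPFunction, fun x hx => (hu.eq_inside x hx).le, fun x hx => (hu.eq_outside x hx).le⟩

theorem IsDPPSolution.isDPPSupersolution {u : EuclideanSpace ℝ (Fin N) → ℝ}
    (hu : IsDPPSolution Ω ε δ K u) : IsDPPSupersolution Ω ε δ K u :=
  ⟨hu.toIsDPPFunction, fun x hx => (hu.eq_inside x hx).ge, fun x hx => (hu.eq_outside x hx).ge⟩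

end Comparison

/-! ### Existence by monotone value iteration under a paraboloid. -/

section Existence

variable {N : ℕ} {Ω : Set (EuclideanSpace ℝ (Fin N))} {ε δ K R : ℝ}

/-- One step of the value iteration. -/
noncomputable def dppStep (Ω : Set (EuclideanSpace ℝ (Fin N))) (ε δ K : ℝ)
    (u : EuclideanSpace ℝ (Fin N) → ℝ) : EuclideanSpace ℝ (Fin N) → ℝ :=
  Ω.indicator fun x => gameOperator ε δ u x + ε ^ 2 * K

/-- Borel functions between `0` and the paraboloid `K ((R + ε)² - ‖x‖²)`, vanishing outside `Ω`. -/
structure IsDPPBarriered (Ω : Set (EuclideanSpace ℝ (Fin N))) (ε K R : ℝ)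
    (u : EuclideanSpace ℝ (Fin N) → ℝ) : Prop where
  measurable : Measurable u
  nonneg : ∀ x, 0 ≤ u x
  eq_zero : ∀ x, x ∉ Ω → u x = 0
  le_paraboloid : ∀ x, ‖x‖ ≤ R + ε → u x ≤ K * ((R + ε) ^ 2 - ‖x‖ ^ 2)

theorem IsDPPBarriered.abs_le {u : EuclideanSpace ℝ (Fin N) → ℝ} (hu : IsDPPBarriered Ω ε K R u)
    (hΩ : ∀ x ∈ Ω, ‖x‖ ≤ R) (hε : 0 < ε) (hK : 0 < K) (x : EuclideanSpace ℝ (Fin N)) :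
    |u x| ≤ K * (R + ε) ^ 2 := by
  rw [abs_of_nonneg (hu.nonneg x)]
  by_cases hx : x ∈ Ω
  · refine (hu.le_paraboloid x (by linarith [hΩ x hx])).trans ?_
    gcongr
    linarith [sq_nonneg ‖x‖]
  · rw [hu.eq_zero x hx]
    positivity

/-- By the parallelogram identity, antipodal values add up to twice the right-hand side. The drop `ε
^ 2 * K` exactly absorbs the running payoff. -/
theorem gameValue_paraboloid_le (hδ : 0 < δ)
    (hδ' : δ < (1 / 2) * (surfaceMeasure N).real Set.univ) (a : ℝ)
    (x : EuclideanSpace ℝ (Fin N)) :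
    gameValue δ (fun v : sphere (0 : EuclideanSpace ℝ (Fin N)) 1 =>
      K * (a - ‖x + ε • (v : EuclideanSpace ℝ (Fin N))‖ ^ 2)) ≤
      K * (a - ‖x‖ ^ 2) - ε ^ 2 * K := by
  refine gameValue_le_of_add_neg_eq hδ hδ' ?_ fun v => ?_
  · exact Continuous.integrable_of_hasCompactSupport (by fun_prop) (HasCompactSupport.of_compactSpace _)
  · have hv : ‖(v : EuclideanSpace ℝ (Fin N))‖ = 1 := by simp
    have h1 := norm_add_sq_real x (ε • (v : EuclideanSpace ℝ (Fin N)))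
    have h2 := norm_sub_sq_real x (ε • (v : EuclideanSpace ℝ (Fin N)))
    have h3 : ‖ε • (v : EuclideanSpace ℝ (Fin N))‖ ^ 2 = ε ^ 2 := by
      rw [norm_smul, hv, mul_one, Real.norm_eq_abs, sq_abs]
    have h4 : x + ε • ((-v : sphere (0 : EuclideanSpace ℝ (Fin N)) 1) : EuclideanSpace ℝ (Fin N)) =
        x - ε • (v : EuclideanSpace ℝ (Fin N)) := by simp [sub_eq_add_neg]
    rw [h4, h1, h2, h3]
    ring

theorem IsDPPBarriered.dppStep {u : EuclideanSpace ℝ (Fin N) → ℝ}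
    (hu : IsDPPBarriered Ω ε K R u) (hΩ_open : IsOpen Ω) (hΩ : ∀ x ∈ Ω, ‖x‖ ≤ R) (hR : 0 ≤ R)
    (hε : 0 < ε) (hδ : 0 < δ) (hδ' : δ < (1 / 2) * (surfaceMeasure N).real Set.univ)
    (hK : 0 < K) : IsDPPBarriered Ω ε K R (dppStep Ω ε δ K u) where
  measurable := ((measurable_gameOperator hδ hδ' hu.measurable (C := K * (R + ε) ^ 2)
    (by positivity) (hu.abs_le hΩ hε hK)).add_const _).indicator hΩ_open.measurableSet
  nonneg x := by
    refine Set.indicator_nonneg (fun x _ => ?_) x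
    have h1 := gameValue_le_add_of_le hδ hδ' (integrable_zero _ _ (surfaceMeasure N))
      (integrable_sphere_of_abs_le hu.measurable (hu.abs_le hΩ hε hK) ε x) (m := 0)
      fun v => by simpa using hu.nonneg _
    have h2 : gameValue δ (0 : sphere (0 : EuclideanSpace ℝ (Fin N)) 1 → ℝ) = 0 := by
      simpa [Pi.zero_def] using gameValue_const_mul (N := N) (δ := δ) (f := 0) (le_refl (0 : ℝ))
    rw [gameOperator_eq_gameValue]
    have : 0 < ε ^ 2 * K := by positivity
    linarith
  eq_zero x hx := Set.indicator_of_notMem hx _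
  le_paraboloid x hx := by
    by_cases hxΩ : x ∈ Ω
    · rw [_root_.dppStep, Set.indicator_of_mem hxΩ, gameOperator_eq_gameValue]
      have h1 := gameValue_paraboloid_le (K := K) (ε := ε) hδ hδ' ((R + ε) ^ 2) x
      have h2 := gameValue_le_add_of_le hδ hδ'
        (integrable_sphere_of_abs_le hu.measurable (hu.abs_le hΩ hε hK) ε x)
        (g := fun v : sphere (0 : EuclideanSpace ℝ (Fin N)) 1 =>
          K * ((R + ε) ^ 2 - ‖x + ε • (v : EuclideanSpace ℝ (Fin N))‖ ^ 2))
        (Continuous.integrable_of_hasCompactSupport (by fun_prop)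
          (HasCompactSupport.of_compactSpace _)) (m := 0) fun v => by
          rw [add_zero]
          -- The radius `R + ε` of the barrier is chosen so that spheres centred in `Ω` stay where
          -- it applies.
          refine hu.le_paraboloid _ ((norm_add_le _ _).trans (add_le_add (hΩ x hxΩ) ?_))
          simp [norm_smul, abs_of_pos hε]
      linarith
    · rw [_root_.dppStep, Set.indicator_of_notMem hxΩ]
      have : ‖x‖ ^ 2 ≤ (R + ε) ^ 2 := by gcongr
      exact mul_nonneg hK.le (by linarith)

theorem exists_isDPPSolution (hΩ_open : IsOpen Ω) (hΩ_bdd : Bornology.IsBounded Ω) (hε : 0 < ε)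
    (hδ : 0 < δ) (hδ' : δ < (1 / 2) * (surfaceMeasure N).real Set.univ) (hK : 0 < K) :
    ∃ u, IsDPPSolution Ω ε δ K u := by
  obtain ⟨R, hR, hΩ⟩ : ∃ R, 0 ≤ R ∧ ∀ x ∈ Ω, ‖x‖ ≤ R := by
    obtain ⟨R, hRpos, hR⟩ := hΩ_bdd.exists_pos_norm_le
    exact ⟨R, hRpos.le, hR⟩
  let U : ℕ → EuclideanSpace ℝ (Fin N) → ℝ := fun n => (dppStep Ω ε δ K)^[n] 0
  have hU_succ (n : ℕ) : U (n + 1) = dppStep Ω ε δ K (U n) := Function.iterate_succ_apply' _ _ _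
  have hU (n : ℕ) : IsDPPBarriered Ω ε K R (U n) := by
    induction n with
    | zero =>
      refine ⟨measurable_zero, fun _ => le_rfl, fun _ _ => rfl, fun x hx => ?_⟩
      have : ‖x‖ ^ 2 ≤ (R + ε) ^ 2 := by gcongr
      exact mul_nonneg hK.le (by linarith)
    | succ n ih => rw [hU_succ]; exact ih.dppStep hΩ_open hΩ hR hε hδ hδ' hK
  have habs (n : ℕ) := (hU n).abs_le hΩ hε hK
  have hint (n : ℕ) (x : EuclideanSpace ℝ (Fin N)) :=
    integrable_sphere_of_abs_le (hU n).measurable (habs n) ε x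
  have hmono_succ (n : ℕ) : ∀ x, U n x ≤ U (n + 1) x := by
    induction n with
    | zero => exact fun x => (hU 1).nonneg x
    | succ n ih =>
      intro x
      rw [hU_succ, hU_succ (n + 1)]
      refine Set.indicator_le_indicator (add_le_add_left ?_ _)
      rw [gameOperator_eq_gameValue, gameOperator_eq_gameValue]
      have := gameValue_le_add_of_le hδ hδ' (hint n x) (hint (n + 1) x) (m := 0)
        fun v => by simpa using ih _
      simpa using this
  have hmono (x : EuclideanSpace ℝ (Fin N)) : Monotone fun n => U n x :=
    monotone_nat_of_le_succ fun n => hmono_succ n x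
  let u : EuclideanSpace ℝ (Fin N) → ℝ := fun x => ⨆ n, U n x
  have hlim (x : EuclideanSpace ℝ (Fin N)) :
      Filter.Tendsto (fun n => U n x) Filter.atTop (𝓝 (u x)) := by
    refine tendsto_atTop_ciSup (hmono x) ⟨K * (R + ε) ^ 2, ?_⟩
    rintro _ ⟨n, rfl⟩
    exact (le_abs_self _).trans (habs n x)
  have hu_meas : Measurable u :=
    measurable_of_tendsto_metrizable (fun n => (hU n).measurable) (tendsto_pi_nhds.2 hlim)
  have hu_abs (x : EuclideanSpace ℝ (Fin N)) : |u x| ≤ K * (R + ε) ^ 2 :=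
    le_of_tendsto (hlim x).abs (Filter.Eventually.of_forall fun n => habs n x)
  have hu_int := integrable_sphere_of_abs_le hu_meas hu_abs ε
  refine ⟨u, ⟨hu_meas, fun x _ => hu_int x⟩, fun x hx => ?_, fun x hx => ?_⟩
  · have hT : Filter.Tendsto (fun n => gameOperator ε δ (U n) x) Filter.atTop
        (𝓝 (gameOperator ε δ u x)) := by
      have h0 : Filter.Tendsto (fun n => (∫ v : sphere (0 : EuclideanSpace ℝ (Fin N)) 1,
          |U n (x + ε • (v : EuclideanSpace ℝ (Fin N))) -
            u (x + ε • (v : EuclideanSpace ℝ (Fin N)))| ∂(surfaceMeasure N)) / (2 * δ))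
          Filter.atTop (𝓝 ((∫ _ : sphere (0 : EuclideanSpace ℝ (Fin N)) 1,
            (0 : ℝ) ∂(surfaceMeasure N)) / (2 * δ))) := by
        refine Filter.Tendsto.div_const ?_ _
        refine tendsto_integral_of_dominated_convergence
          (fun _ => K * (R + ε) ^ 2 + K * (R + ε) ^ 2)
          (fun n => ((hint n x).sub (hu_int x)).abs.aestronglyMeasurable) (integrable_const _)
          (fun n => Filter.Eventually.of_forall fun v => ?_)
          (Filter.Eventually.of_forall fun v => ?_)
        · rw [Real.norm_eq_abs, abs_abs]
          exact (abs_sub _ _).trans (add_le_add (habs n _) (hu_abs _))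
        · have := ((hlim (x + ε • (v : EuclideanSpace ℝ (Fin N)))).sub_const
            (u (x + ε • (v : EuclideanSpace ℝ (Fin N))))).abs
          simpa using this
      rw [integral_zero, zero_div] at h0
      rw [tendsto_iff_dist_tendsto_zero]
      refine squeeze_zero (fun _ => dist_nonneg) (fun n => ?_) h0
      rw [Real.dist_eq]
      exact abs_gameValue_sub_le hδ hδ' (hint n x) (hu_int x)
    refine tendsto_nhds_unique ((hlim x).comp (Filter.tendsto_add_atTop_nat 1)) ?_
    refine (hT.add_const (ε ^ 2 * K)).congr fun n => ?_
    rw [Function.comp_apply, hU_succ, dppStep, Set.indicator_of_mem hx]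
  · have h0 : ∀ n, U n x = 0 := fun n => (hU n).eq_zero x hx
    simp only [u, h0, ciSup_const]

end Existence

theorem theorem1p1 (N : ℕ) (hN : 2 ≤ N) (Ω : Set (EuclideanSpace ℝ (Fin N)))
    (hΩ_open : IsOpen Ω) (hΩ_bdd : Bornology.IsBounded Ω)
    (ε δ K : ℝ) (hε : 0 < ε) (hδ : 0 < δ)
    (hδ' : δ < (1 / 2) * (surfaceMeasure N).real Set.univ) (hK : 0 < K) :
    (∃! u : EuclideanSpace ℝ (Fin N) → ℝ, IsDPPSolution Ω ε δ K u) ∧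
    (∀ uSuper uSub : EuclideanSpace ℝ (Fin N) → ℝ,
      IsDPPSupersolution Ω ε δ K uSuper → IsDPPSubsolution Ω ε δ K uSub →
        ∀ x, uSub x ≤ uSuper x) := by
  have comparison : ∀ uSuper uSub : EuclideanSpace ℝ (Fin N) → ℝ,
      IsDPPSupersolution Ω ε δ K uSuper → IsDPPSubsolution Ω ε δ K uSub →
        ∀ x, uSub x ≤ uSuper x := fun uSuper uSub hsuper hsub =>
    hsub.le_supersolution hN hΩ_bdd hε hδ hδ' hK hsuper
  obtain ⟨u, hu⟩ := exists_isDPPSolution hΩ_open hΩ_bdd hε hδ hδ' hK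
  refine ⟨⟨u, hu, fun w hw => funext fun x => le_antisymm ?_ ?_⟩, comparison⟩
  · exact comparison u w hu.isDPPSupersolution hw.isDPPSubsolution x
  · exact comparison w u hw.isDPPSupersolution hu.isDPPSubsolution x
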